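/- Let $\mathcal A$ be a unital $C^*$-algebra and let $\mathcal A_{\mathbb Z}=\mathcal A^{\otimes\mathbb Z}$ be its infinite (maximal) $C^*$-tensor power over $\mathbb Z$; when $\mathcal A$ is nuclear this is the unique infinite $C^*$-tensor power. For $j\in\mathbb Z$ let $\iota_j:\mathcal A\to\mathcal A_{\mathbb Z}$ be the embedding at the site $j$. For $I\subseteq\mathbb Z$ let $\mathcal A_I$ be the unital $C^*$-subalgebra generated by $\iota_j(\mathcal A)$, $j\in I$, and put $\mathcal A_R=\mathcal A_{\{1,2,\dots\}}$, $\mathcal A_L=\mathcal A_{\{\dots,-1,0\}}$, $\mathcal A_{(n)}=\mathcal A_{\{1,\dots,n\}}$. Let $S$ be the shift automorphism, $S(\iota_j(a))=\iota_{j+1}(a)$, and let $\omega$ be a shift invariant state on $\mathcal A_{\mathbb Z}$, $\omega\circ S=\omega$. Let $\mathcal K_\omega=\{a\in\mathcal A_R:\ \omega(xa)=0\ \text{for all } x\in\mathcal A_L\}$, let $\mathcal B_\omega=\mathcal A_R/\mathcal K_\omega$ with classes $\lfloor a\rfloor$, involution $\lfloor a\rfloor^*=\lfloor a^*\rfloor$,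 unit $e=\lfloor 1\rfloor$, and let $\bar\omega(\lfloor a\rfloor)=\omega(a)$. Equip $\mathcal B_\omega$ with the cones $$\mathcal C_n=\big\{[\lfloor a_{ij}\rfloor]\in M_n(\mathcal B_\omega):\ \forall\,\varepsilon>0\ \exists\,k_{ij}\in\mathcal K_\omega\ \text{with}\ \varepsilon 1+[a_{ij}+k_{ij}]\in M_n(\mathcal A_R)^+\big\}$$ and with the associated operator system norm $$\|b\|=\inf\Big\{r\in\mathbb R:\ \begin{pmatrix} re & b\\ b^* & re\end{pmatrix}\in\mathcal C_2\Big\}.$$ The generating maps $\mathbb E:\mathcal A\otimes\mathcal B_\omega\to\mathcal B_\omega$ and $\mathbb E_{(n)}:\mathcal A_{(n)}\otimes\mathcal B_\omega\to\mathcal B_\omega$ ($n\ge 1$) are the well-defined linear maps with $$\mathbb E(a\otimes\lfloor a_R\rfloor)=\lfloor S(\iota_0(a)\,a_R)\rfloor,\qquad \mathbb E_{(n)}(x\otimes\lfloor a_R\rfloor)=\lfloor S^n(S^{-n}(x)\,a_R)\rfloor ,$$ and $\bar S:\mathcal B_\omega\to\mathcal B_\omega$ is given by $\bar S(b)=\mathbb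 E(1\otimes b)$. Assume that $\lim_{r\to\infty}\bar S^{\circ r}(b)=\bar\omega(b)\,e$ in $\mathcal B_\omega$ for every $b\in\mathcal B_\omega$. Then $\mathbb E$ is full: for every nonzero $b\in\mathcal B_\omega$, $$\overline{\bigcup_{n\ge1}\ \bigcup_{x\in\mathcal A_{(n)}}\mathbb E_{(n)}(x\otimes b)}=\mathcal B_\omega ,$$ where limits and closures are taken in the operator system norm. -/

import Mathlib

open scoped ENNReal TensorProduct Matrix ComplexOrder
open Filter Topology

noncomputable section

namespace SpinChain

universe u

/-! ### The algebra of physical observables -/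

/-- A family of pairwise commuting unital `*`-homomorphisms `π j : A → D`, `j ∈ ℤ`, into a nonzero
unital `C*`-algebra `D`. Such a family is the same thing as a unital `*`-representation of the
algebraic (restricted) infinite tensor power of `A` over `ℤ`. -/
structure CommSystem (A : Type u) [CStarAlgebra A] : Type (u + 1) where
  D : Type u
  [cstar : CStarAlgebra D]
  [nontriv : Nontrivial D]
  π : ℤ → A →⋆ₐ[ℂ] D
  comm : ∀ i j : ℤ, i ≠ j → ∀ a b : A, Commute (π i a) (π j b)

attribute [instance] CommSystem.cstar CommSystem.nontriv

variable {A : Type u} [CStarAlgebra A]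

/-- Reindexing of a commuting system by a translation of `ℤ`. -/
def CommSystem.translate (s : CommSystem A) (k : ℤ) : CommSystem A where
  D := s.D
  π := fun j => s.π (j + k)
  comm := fun i j h a b => s.comm (i + k) (j + k) (by omega) a b

/-- The `C*`-algebra of bounded families indexed by all commuting systems. -/
abbrev Univ (A : Type u) [CStarAlgebra A] : Type (u + 1) :=
  lp (fun s : CommSystem A => s.D) ∞

instance : CStarAlgebra (Univ A) where

/-- The component of a bounded family at a commuting system. -/
def Univ.at (f : Univ A) (s : CommSystem A) : s.D :=
  (show lp (fun s : CommSystem A => s.D) ∞ from f) s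

theorem Univ.ext {f g : Univ A} (h : ∀ s, f.at s = g.at s) : f = g :=
  lp.ext (funext h)

/-- The `j`-th copy of `A` in the universal representation: `a ↦ (π j a)_π`. -/
def univEmb (j : ℤ) : A →⋆ₐ[ℂ] Univ A where
  toFun a := (⟨fun s => s.π j a, memℓp_infty ⟨‖a‖, by
    rintro _ ⟨s, rfl⟩
    exact NonUnitalStarAlgHom.norm_apply_le (s.π j) a⟩⟩ : lp (fun s : CommSystem A => s.D) ∞)
  map_one' := Univ.ext fun s => map_one (s.π j)
  map_mul' a b := Univ.ext fun s => map_mul (s.π j) a b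
  map_zero' := Univ.ext fun s => map_zero (s.π j)
  map_add' a b := Univ.ext fun s => map_add (s.π j) a b
  commutes' r := Univ.ext fun s => AlgHomClass.commutes (s.π j) r
  map_star' a := Univ.ext fun s => map_star (s.π j) a

/-- The closed unital `*`-subalgebra generated by all the copies of `A`. -/
def chainSubalgebra (A : Type u) [CStarAlgebra A] : StarSubalgebra ℂ (Univ A) :=
  (StarAlgebra.adjoin ℂ {y : Univ A | ∃ (j : ℤ) (a : A), univEmb j a = y}).topologicalClosure

/-- The algebra of observables `A_ℤ`, the infinite tensor power of `A` over `ℤ`: the closure of the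
image of the algebraic tensor power under its universal representation, that is, the completion of
the algebraic tensor power in the maximal `C*`-norm. For nuclear `A` this is the only `C*`-norm. -/
def Chain (A : Type u) [CStarAlgebra A] : Type (u + 1) := chainSubalgebra A

instance : IsClosed (chainSubalgebra A : Set (Univ A)) :=
  StarSubalgebra.isClosed_topologicalClosure _

/-- The `C*`-algebra structure of `A_ℤ`, inherited from the ambient algebra. -/
def chainCStarAlgebra (A : Type u) [CStarAlgebra A] : CStarAlgebra (Chain A) :=
  inferInstanceAs (CStarAlgebra (chainSubalgebra A))

attribute [instance] chainCStarAlgebra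

/-- The identification of `A_ℤ` with a subalgebra of the ambient algebra. -/
def chainEquiv (A : Type u) [CStarAlgebra A] : Chain A ≃⋆ₐ[ℂ] chainSubalgebra A where
  toFun x := x
  invFun x := x
  left_inv _ := rfl
  right_inv _ := rfl
  map_mul' _ _ := rfl
  map_add' _ _ := rfl
  map_smul' _ _ := rfl
  map_star' _ := rfl

attribute [irreducible] chainCStarAlgebra

theorem continuous_starAlgHom {B C : Type*} [CStarAlgebra B] [CStarAlgebra C] (f : B →⋆ₐ[ℂ] C) :
    Continuous f :=
  AddMonoidHomClass.continuous_of_bound f 1 fun x => by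
    rw [one_mul]
    exact NonUnitalStarAlgHom.norm_apply_le f x

/-- The component of an observable at a commuting system, that is, its image under the
representation of `A_ℤ` given by the system. -/
def Chain.at (f : Chain A) (s : CommSystem A) : s.D := (chainEquiv A f).1.at s

theorem Chain.ext {f g : Chain A} (h : ∀ s, f.at s = g.at s) : f = g :=
  (chainEquiv A).injective (Subtype.ext (Univ.ext h))

theorem Chain.at_mul (f g : Chain A) (s : CommSystem A) : (f * g).at s = f.at s * g.at s := by
  unfold Chain.at
  rw [map_mul]
  rfl

/-- The embedding `α_j⁻¹` of `A` onto the copy of `A` at the site `j`. -/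
def site (j : ℤ) : A →⋆ₐ[ℂ] Chain A :=
  ((chainEquiv A).symm : chainSubalgebra A →⋆ₐ[ℂ] Chain A).comp <|
    StarAlgHom.codRestrict (univEmb j) (chainSubalgebra A) fun a =>
      StarSubalgebra.le_topologicalClosure _ (StarAlgebra.subset_adjoin ℂ _ ⟨j, a, rfl⟩)

theorem site_at (j : ℤ) (a : A) (s : CommSystem A) : (site j a).at s = s.π j a := by
  unfold Chain.at site
  simp
  rfl

/-- The `C*`-subalgebra of `A_ℤ` generated by the sites in `I`. -/
def region (A : Type u) [CStarAlgebra A] (I : Set ℤ) : StarSubalgebra ℂ (Chain A) :=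
  (StarAlgebra.adjoin ℂ {y : Chain A | ∃ j ∈ I, ∃ a : A, site j a = y}).topologicalClosure

/-- `A_R = A_(1,∞)`. -/
abbrev right (A : Type u) [CStarAlgebra A] : StarSubalgebra ℂ (Chain A) := region A (Set.Ici 1)

/-- `A_L = A_(-∞,0)`. -/
abbrev left (A : Type u) [CStarAlgebra A] : StarSubalgebra ℂ (Chain A) := region A (Set.Iic 0)

/-- `A_(n) = A_(1,n)`. -/
abbrev block (A : Type u) [CStarAlgebra A] (n : ℕ) : StarSubalgebra ℂ (Chain A) :=
  region A (Set.Icc 1 (n : ℤ))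

/-! ### The shift -/

def univShift (A : Type u) [CStarAlgebra A] (k : ℤ) : Univ A →⋆ₐ[ℂ] Univ A where
  toFun f := (⟨fun s => f.at (s.translate k), memℓp_infty ⟨‖f‖, by
    rintro _ ⟨s, rfl⟩
    exact lp.norm_apply_le_norm ENNReal.top_ne_zero
      (show lp (fun s : CommSystem A => s.D) ∞ from f) (s.translate k)⟩⟩ :
    lp (fun s : CommSystem A => s.D) ∞)
  map_one' := Univ.ext fun s => rfl
  map_mul' a b := Univ.ext fun s => rfl
  map_zero' := Univ.ext fun s => rfl
  map_add' a b := Univ.ext fun s => rfl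
  commutes' r := Univ.ext fun s => rfl
  map_star' a := Univ.ext fun s => rfl

theorem univShift_univEmb (k j : ℤ) (a : A) : univShift A k (univEmb j a) = univEmb (j + k) a :=
  Univ.ext fun _ => rfl

theorem univShift_mem (k : ℤ) (f : Univ A) (hf : f ∈ chainSubalgebra A) :
    univShift A k f ∈ chainSubalgebra A := by
  have hc : Continuous (univShift A k) := continuous_starAlgHom _
  have hle : StarAlgebra.adjoin ℂ {y : Univ A | ∃ (j : ℤ) (a : A), univEmb j a = y} ≤
      (chainSubalgebra A).comap (univShift A k) := by
    rw [StarAlgebra.adjoin_le_iff]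
    rintro _ ⟨j, a, rfl⟩
    show univShift A k (univEmb j a) ∈ chainSubalgebra A
    rw [univShift_univEmb]
    exact StarSubalgebra.le_topologicalClosure _ (StarAlgebra.subset_adjoin ℂ _ ⟨j + k, a, rfl⟩)
  exact StarSubalgebra.topologicalClosure_minimal hle
    ((StarSubalgebra.isClosed_topologicalClosure _).preimage hc) hf

/-- The `k`-th power `S^k` of the shift automorphism of `A_ℤ`: it moves the entry at the site `j`
to the site `j + k`. The shift itself is `S = shift 1`. -/
def shift (k : ℤ) : Chain A →⋆ₐ[ℂ] Chain A :=
  ((chainEquiv A).symm : chainSubalgebra A →⋆ₐ[ℂ] Chain A).comp <|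
    (StarAlgHom.codRestrict ((univShift A k).comp (chainSubalgebra A).subtype) (chainSubalgebra A)
      fun f => univShift_mem k f.1 f.2).comp (chainEquiv A : Chain A →⋆ₐ[ℂ] chainSubalgebra A)

theorem shift_at (k : ℤ) (f : Chain A) (s : CommSystem A) :
    (shift k f).at s = f.at (s.translate k) := by
  unfold Chain.at shift
  simp
  rfl

theorem shift_site (k j : ℤ) (a : A) : shift k (site j a) = site (j + k) a :=
  Chain.ext fun s => by rw [shift_at, site_at, site_at]; rfl

theorem shift_shift (k l : ℤ) (f : Chain A) : shift k (shift l f) = shift (k + l) f := by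
  refine Chain.ext fun s => ?_
  rw [shift_at, shift_at, shift_at]
  have : (s.translate k).translate l = s.translate (k + l) := by
    have h : (fun j => s.π (j + l + k)) = fun j => s.π (j + (k + l)) := by
      funext j
      rw [add_assoc, add_comm l k]
    simp only [CommSystem.translate]
    congr 1
  exact eq_of_heq (congr_arg_heq f.at this)

theorem shift_zero (f : Chain A) : shift 0 f = f := by
  refine Chain.ext fun s => ?_
  rw [shift_at]
  have : s.translate 0 = s := by
    cases s
    simp [CommSystem.translate]
  exact eq_of_heq (congr_arg_heq f.at this)

theorem site_mem_region {I : Set ℤ} {j : ℤ} (hj : j ∈ I) (a : A) : site j a ∈ region A I :=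
  StarSubalgebra.le_topologicalClosure _ (StarAlgebra.subset_adjoin ℂ _ ⟨j, hj, a, rfl⟩)

theorem region_le {I : Set ℤ} {T : StarSubalgebra ℂ (Chain A)} (hT : IsClosed (T : Set (Chain A)))
    (h : ∀ j ∈ I, ∀ a : A, site j a ∈ T) : region A I ≤ T := by
  refine StarSubalgebra.topologicalClosure_minimal ?_ hT
  rw [StarAlgebra.adjoin_le_iff]
  rintro _ ⟨j, hj, a, rfl⟩
  exact h j hj a

instance isClosed_region (I : Set ℤ) : IsClosed (region A I : Set (Chain A)) :=
  StarSubalgebra.isClosed_topologicalClosure _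

theorem region_mono {I J : Set ℤ} (h : I ⊆ J) : region A I ≤ region A J :=
  region_le (isClosed_region J) fun _ hj a => site_mem_region (h hj) a

theorem shift_mem_region {I J : Set ℤ} (k : ℤ) (h : ∀ j ∈ I, j + k ∈ J) {f : Chain A}
    (hf : f ∈ region A I) : shift k f ∈ region A J := by
  have hc : Continuous (shift (A := A) k) := continuous_starAlgHom _
  refine region_le (T := (region A J).comap (shift k)) ((isClosed_region J).preimage hc) ?_ hf
  intro j hj a
  show shift k (site j a) ∈ region A J
  rw [shift_site]
  exact site_mem_region (h j hj) a

theorem site_commute {i j : ℤ} (h : i ≠ j) (a b : A) : Commute (site i a) (site j b) := by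
  refine Chain.ext fun s => ?_
  rw [Chain.at_mul, Chain.at_mul, site_at, site_at]
  exact s.comm i j h a b

theorem commute_of_mem_region {K : Set ℤ} {y : Chain A}
    (h : ∀ j ∈ K, ∀ a : A, Commute y (site j a)) {x : Chain A} (hx : x ∈ region A K) :
    Commute y x := by
  have hc : IsClosed (StarSubalgebra.centralizer ℂ ({y} : Set (Chain A)) : Set (Chain A)) := by
    rw [StarSubalgebra.coe_centralizer]
    exact Set.isClosed_centralizer _
  refine ((StarSubalgebra.mem_centralizer_iff ℂ).1
    (region_le hc (fun j hj a => (StarSubalgebra.mem_centralizer_iff ℂ).2 ?_) hx) y rfl).1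
  intro g hg
  rw [Set.mem_singleton_iff.1 hg]
  refine ⟨h j hj a, ?_⟩
  have h' := (h j hj (star a)).star_star
  rw [map_star, star_star] at h'
  exact h'

/-- Elements supported in disjoint regions commute. -/
theorem region_commute {I J : Set ℤ} (h : Disjoint I J) {x y : Chain A}
    (hx : x ∈ region A I) (hy : y ∈ region A J) : Commute x y := by
  refine (commute_of_mem_region (fun i hi a => ?_) hx).symm
  refine (commute_of_mem_region (fun j hj b => ?_) hy).symm
  refine site_commute (fun hij => ?_) a b
  subst hij
  exact Set.disjoint_left.1 h hi hj

/-! ### Shift invariant states, the entanglement kernel and the reduced space -/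

/-- A shift invariant state on `A_ℤ`. -/
structure ShiftInvariantState (A : Type u) [CStarAlgebra A] where
  toFunctional : Chain A →L[ℂ] ℂ
  nonneg : ∀ a : Chain A, 0 ≤ toFunctional (star a * a)
  map_one : toFunctional 1 = 1
  map_shift : ∀ a : Chain A, toFunctional (shift 1 a) = toFunctional a

namespace ShiftInvariantState

instance : CoeFun (ShiftInvariantState A) fun _ => Chain A → ℂ := ⟨fun ω => ω.toFunctional⟩

variable (ω : ShiftInvariantState A)

/-- The functional `ω_x : A_R → ℂ`, `ω_x a = ω (x a)`. -/
def functionalAt (x : left A) : right A →ₗ[ℂ] ℂ where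
  toFun a := ω ((x : Chain A) * (a : Chain A))
  map_add' a b := by
    show ω.toFunctional ((x : Chain A) * ((a : Chain A) + (b : Chain A))) = _
    rw [mul_add, map_add]
  map_smul' c a := by
    show ω.toFunctional ((x : Chain A) * (c • (a : Chain A))) = _
    rw [mul_smul_comm, map_smul]
    rfl

/-- The entanglement kernel `K_ω`, the intersection of the kernels of all `ω_x`, `x ∈ A_L`. -/
def entanglementKernel : Submodule ℂ (right A) :=
  ⨅ x : left A, LinearMap.ker (ω.functionalAt x)

theorem mem_entanglementKernel {a : right A} :
    a ∈ ω.entanglementKernel ↔ ∀ x ∈ left A, ω (x * (a : Chain A)) = 0 := by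
  rw [entanglementKernel, Submodule.mem_iInf]
  exact ⟨fun h x hx => h ⟨x, hx⟩, fun h x => h x x.2⟩

theorem map_star (a : Chain A) : ω (star a) = star (ω a) := by
  have h1 := (Complex.nonneg_iff.1 (ω.nonneg (a + 1))).2
  have h2 := (Complex.nonneg_iff.1 (ω.nonneg (Complex.I • a + 1))).2
  have h3 := (Complex.nonneg_iff.1 (ω.nonneg a)).2
  simp only [star_add, star_one, add_mul, mul_add, mul_one, one_mul, map_add, ω.map_one, star_smul,
    smul_mul_assoc, mul_smul_comm, map_smul, smul_eq_mul, Complex.add_im, Complex.one_im] at h1 h2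
  simp at h2
  apply Complex.ext
  · simp
    linarith
  · simp
    linarith

theorem star_mem_entanglementKernel {a : right A} (ha : a ∈ ω.entanglementKernel) :
    star a ∈ ω.entanglementKernel := by
  rw [mem_entanglementKernel] at ha ⊢
  intro x hx
  have hcomm : Commute (star x) (a : Chain A) :=
    region_commute (Set.disjoint_left.2 fun i hi hj => by
      simp only [Set.mem_Iic, Set.mem_Ici] at hi hj; omega) (star_mem hx) a.2
  have h := ha (star x) (star_mem hx)
  have h' : x * ((star a : right A) : Chain A) = star (star x * (a : Chain A)) := by
    rw [hcomm.eq]; simp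
  rw [h', ω.map_star, h, star_zero]

/-- The reduced space `B_ω = A_R / K_ω`. -/
abbrev Reduced : Type (u + 1) := right A ⧸ ω.entanglementKernel

/-- The quotient map `q : A_R → B_ω`, `a ↦ ⌊a⌋`. -/
abbrev q : right A →ₗ[ℂ] ω.Reduced := ω.entanglementKernel.mkQ

/-- The unit `e = ⌊1⌋` of the reduced space. -/
def e : ω.Reduced := ω.q 1

/-- The involution of the reduced space, `⌊a⌋* = ⌊a*⌋`. -/
def conj (b : ω.Reduced) : ω.Reduced :=
  Quotient.map' (fun a : right A => star a) (fun a a' h => by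
    rw [Submodule.quotientRel_def] at h ⊢
    rw [← star_sub]
    exact ω.star_mem_entanglementKernel h) b

/-- The reduced state, `ω̄ ⌊a⌋ = ω a`. -/
def reducedState : ω.Reduced →ₗ[ℂ] ℂ :=
  ω.entanglementKernel.liftQ (ω.functionalAt 1) (iInf_le _ 1)

/-! ### The operator system structure of the reduced space -/

/-- The positive cone of `M_n(A_R)`. -/
def matrixPos (n : ℕ) : Set (Matrix (Fin n) (Fin n) (right A)) :=
  {P | ∃ Q : Matrix (Fin n) (Fin n) (right A), P = Qᴴ * Q}

/-- The Archimedean cones `C_n ⊆ M_n(B_ω)`: the matrix `[⌊a_ij⌋]` belongs to `C_n` if, for all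
`ε > 0`, there are `k_ij ∈ K_ω` such that `ε 1 + [a_ij + k_ij]` is positive in `M_n(A_R)`. -/
def cone (n : ℕ) : Set (Matrix (Fin n) (Fin n) ω.Reduced) :=
  {M | ∀ ε : ℝ, 0 < ε → ∃ P : Matrix (Fin n) (Fin n) (right A),
    P.map ω.q = M ∧ (ε : ℂ) • (1 : Matrix (Fin n) (Fin n) (right A)) + P ∈ matrixPos n}

/-- The norm of the operator system `B_ω`: the infimum of the real `r` for which the matrix with
rows `(r e, b)` and `(b*, r e)` is in the cone `C_2`. -/
def osyNorm (b : ω.Reduced) : ℝ :=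
  sInf {r : ℝ | !![(r : ℂ) • ω.e, b; ω.conj b, (r : ℂ) • ω.e] ∈ ω.cone 2}

/-- The closure of a subset of `B_ω` in the operator system norm. -/
def osyClosure (s : Set ω.Reduced) : Set ω.Reduced :=
  {b | ∀ ε : ℝ, 0 < ε → ∃ c ∈ s, ω.osyNorm (c - b) < ε}

/-! ### The generating maps -/

theorem map_shift_int (k : ℤ) (f : Chain A) : ω (shift k f) = ω f := by
  induction k using Int.induction_on generalizing f with
  | zero => rw [shift_zero]
  | succ n ih => rw [← shift_shift, ih, ω.map_shift]
  | pred n ih =>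
    rw [← ω.map_shift, shift_shift, show (1 + (-(n : ℤ) - 1)) = -(n : ℤ) by ring, ih]

/-- The element `S^n (z · a)` of `A_R`, for `z` supported on the sites `-n+1, …, 0` and
`a ∈ A_R`. -/
def shiftMul (n : ℕ) (z : region A (Set.Icc (-(n : ℤ) + 1) 0)) (a : right A) : right A :=
  ⟨shift n ((z : Chain A) * (a : Chain A)), by
    refine shift_mem_region (I := Set.Ici (-(n : ℤ) + 1)) (n : ℤ) (fun j hj => ?_)
      (mul_mem (region_mono (fun j hj => hj.1) z.2) (region_mono (fun j hj => ?_) a.2))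
    · simp only [Set.mem_Ici] at hj ⊢; omega
    · simp only [Set.mem_Ici] at hj ⊢; omega⟩

theorem shiftMul_mem (n : ℕ) (z : region A (Set.Icc (-(n : ℤ) + 1) 0)) {a : right A}
    (ha : a ∈ ω.entanglementKernel) : shiftMul n z a ∈ ω.entanglementKernel := by
  rw [mem_entanglementKernel] at ha ⊢
  intro x hx
  have h : x * shift n ((z : Chain A) * (a : Chain A)) =
      shift n ((shift (-(n : ℤ)) x * (z : Chain A)) * (a : Chain A)) := by
    rw [mul_assoc, map_mul (shift (n : ℤ)) (shift (-(n : ℤ)) x), shift_shift, add_neg_cancel,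
      shift_zero]
  show ω (x * shift n ((z : Chain A) * (a : Chain A))) = 0
  rw [h, map_shift_int]
  refine ha _ (mul_mem (shift_mem_region _ (fun j hj => ?_) hx) (region_mono (fun j hj => hj.2) z.2))
  simp only [Set.mem_Iic] at hj ⊢; omega

/-- The bilinear map `(z, ⌊a⌋) ↦ ⌊S^n (z · a)⌋`. -/
def shiftMulBilin (n : ℕ) :
    region A (Set.Icc (-(n : ℤ) + 1) 0) →ₗ[ℂ] ω.Reduced →ₗ[ℂ] ω.Reduced where
  toFun z := ω.entanglementKernel.mapQ ω.entanglementKernel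
    { toFun := shiftMul n z
      map_add' := fun a b => Subtype.ext (by simp [shiftMul, mul_add])
      map_smul' := fun c a => Subtype.ext (by simp [shiftMul]) }
    (fun _ ha => ω.shiftMul_mem n z ha)
  map_add' z w := by
    ext a
    exact congrArg ω.q (Subtype.ext (by simp [shiftMul, add_mul]))
  map_smul' c z := by
    ext a
    exact congrArg ω.q (Subtype.ext (by simp [shiftMul]))

/-- The isomorphism `S^{-n}` of `A_(n) = A_(1,n)` onto `A_(-n+1,0)`. -/
def shiftBlock (A : Type u) [CStarAlgebra A] (n : ℕ) :
    block A n →ₗ[ℂ] region A (Set.Icc (-(n : ℤ) + 1) 0) where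
  toFun x := ⟨shift (-(n : ℤ)) (x : Chain A), shift_mem_region _ (fun j hj => by
    simp only [Set.mem_Icc] at hj ⊢; omega) x.2⟩
  map_add' x y := Subtype.ext (by simp)
  map_smul' c x := Subtype.ext (by simp)

/-- The embedding of `A` at the site `0`, as a linear map onto `A_(0,0)`. -/
def siteZero (A : Type u) [CStarAlgebra A] : A →ₗ[ℂ] region A (Set.Icc (-((1 : ℕ) : ℤ) + 1) 0) where
  toFun a := ⟨site 0 a, site_mem_region (by simp) a⟩
  map_add' x y := Subtype.ext (by simp)
  map_smul' c x := Subtype.ext (by simp)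

/-- The generating map `𝔼`, determined by `𝔼 (a ⊗ ⌊a_R⌋) = ⌊S (α_0⁻¹ a · a_R)⌋`. -/
def gen : A ⊗[ℂ] ω.Reduced →ₗ[ℂ] ω.Reduced :=
  TensorProduct.lift (ω.shiftMulBilin 1 ∘ₗ siteZero A)

/-- The generating map `𝔼_(n)`, determined by `𝔼_(n) (x ⊗ ⌊a_R⌋) = ⌊S^n (S^{-n} x · a_R)⌋`; so
`(a_1 ⊗ ⋯ ⊗ a_n) ⊗ ⌊a_R⌋` is sent to
`⌊S^n (α_{-n+1}⁻¹ a_1 ⊗ ⋯ ⊗ α_0⁻¹ a_n ⊗ a_R)⌋`. -/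
def genN (n : ℕ) : block A n ⊗[ℂ] ω.Reduced →ₗ[ℂ] ω.Reduced :=
  TensorProduct.lift (ω.shiftMulBilin n ∘ₗ shiftBlock A n)

/-- The shift map of the reduced space, `S̄ b = 𝔼 (1 ⊗ b)`. -/
def reducedShift (b : ω.Reduced) : ω.Reduced := ω.gen ((1 : A) ⊗ₜ[ℂ] b)

/-- The generating map is full: for every nonzero `b`, the elements `𝔼_(n) (x ⊗ b)` with `n ≥ 1`
and `x ∈ A_(n)` are dense in the reduced space. -/
def IsFull : Prop :=
  ∀ b : ω.Reduced, b ≠ 0 →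
    ω.osyClosure (⋃ n ≥ (1 : ℕ), ⋃ x : block A n, {ω.genN n (x ⊗ₜ[ℂ] b)}) = Set.univ

end ShiftInvariantState

end SpinChain

end

namespace SpinChain

universe u

/-! ### Gram factorisations of 2×2 matrices over a `C*`-algebra -/

section MatrixPositivity

variable {B : Type*} [CStarAlgebra B]

/-! If `b = ⌊a⌋` is nonzero, some `x ∈ A_L` has `ω(x a) ≠ 0`. By continuity `x` may be taken
finitely supported, and by shift invariance this yields `b' = 𝔼_(m)(x ⊗ b)` with `t = ω̄(b') ≠ 0`
(`exists_reducedState_genN_ne_zero`). The hypothesis gives `S̄^r b' → t e`, so applying `𝔼_(n)(t⁻¹y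
⊗ ·)` gives elements converging to `⌊y⌋`. By `genN_comp` each of them is again of the form `𝔼_(N)(z
⊗ b)`. The classes `⌊y⌋` of finitely supported `y` are dense, because the operator system norm of
`⌊a⌋` is at most `‖a‖`.

The analytic point is that `𝔼_(n)(y ⊗ ·)` is bounded in the operator system norm
(`exists_osyNorm_genN_le`). Given a positive lift of the matrix with rows `(r e, b)`, `(b*, r e)`,
shift it by `n`, conjugate by `diag(y, 1)`, and fill the diagonal up to `c r` with `c = max 1 ‖y‖²`.
The result is a positive lift of the matrix for `𝔼_(n)(y ⊗ b)` with radius `c r`. -/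

theorem exists_star_mul_self_add (x y : B) : ∃ t : B, star x * x + star y * y = star t * t := by
  let := CStarAlgebra.spectralOrder B
  have := CStarAlgebra.spectralOrderedRing B
  exact CStarAlgebra.nonneg_iff_eq_star_mul_self.1
    (add_nonneg (star_mul_self_nonneg x) (star_mul_self_nonneg y))

/-- Sums of matrices of the form `Qᴴ * Q` over a `C*`-algebra are again of this form. -/
theorem exists_conjTranspose_mul_self_add {n : ℕ} (Q R : Matrix (Fin n) (Fin n) B) :
    ∃ T : Matrix (Fin n) (Fin n) B, Qᴴ * Q + Rᴴ * R = Tᴴ * T := by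
  let := CStarAlgebra.spectralOrder B
  have := CStarAlgebra.spectralOrderedRing B
  obtain ⟨T, hT⟩ := exists_star_mul_self_add (CStarMatrix.ofMatrix Q) (CStarMatrix.ofMatrix R)
  exact ⟨CStarMatrix.ofMatrix.symm T, hT⟩

theorem exists_smul_one_sub_mul_star_eq (y : B) {c : ℝ} (hc : ‖y‖ ^ 2 ≤ c) :
    ∃ w : B, (c : ℂ) • (1 : B) - y * star y = star w * w := by
  let := CStarAlgebra.spectralOrder B
  have := CStarAlgebra.spectralOrderedRing B
  have h : y * star y ≤ algebraMap ℝ B c :=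
    CStarAlgebra.mul_star_le_algebraMap_norm_sq.trans (algebraMap_mono B hc)
  obtain ⟨w, hw⟩ := CStarAlgebra.nonneg_iff_eq_star_mul_self.1 (sub_nonneg.2 h)
  refine ⟨w, ?_⟩
  rw [← hw, Algebra.algebraMap_eq_smul_one]
  rfl

theorem star_real_sqrt_smul_mul_self (w : B) {t : ℝ} (ht : 0 ≤ t) :
    star ((√t : ℂ) • w) * ((√t : ℂ) • w) = (t : ℂ) • (star w * w) := by
  rw [star_smul, smul_mul_smul_comm, Complex.star_def, Complex.conj_ofReal, ← Complex.ofReal_mul,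
    Real.mul_self_sqrt ht]

theorem exists_conjTranspose_mul_self_diag (u v : B) :
    ∃ T : Matrix (Fin 2) (Fin 2) B, !![star u * u, 0; 0, star v * v] = Tᴴ * T := by
  refine ⟨!![u, 0; 0, v], ?_⟩
  ext i j
  fin_cases i <;> fin_cases j <;> simp [Matrix.mul_apply, Fin.sum_univ_two]

/-- The matrix is the Gram matrix of the row `(√t, a/√t)` plus `diag(0, t⁻¹(t² - a*a))`, and the
second summand is positive because `‖a‖ < t`. -/
theorem exists_conjTranspose_mul_self_of_norm_lt (a : B) {t : ℝ} (ht : ‖a‖ < t) :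
    ∃ T : Matrix (Fin 2) (Fin 2) B, !![(t : ℂ) • 1, a; star a, (t : ℂ) • 1] = Tᴴ * T := by
  have ht₀ : 0 < t := (norm_nonneg a).trans_lt ht
  have htc : (t : ℂ) ≠ 0 := by exact_mod_cast ht₀.ne'
  have hs : 0 ≤ t⁻¹ := by positivity
  obtain ⟨w, hw⟩ := exists_smul_one_sub_mul_star_eq (star a) (c := t ^ 2)
    (by rw [norm_star]; gcongr)
  rw [star_star] at hw
  have h₁ : !![(t : ℂ) • 1, a; star a, ((t⁻¹ : ℝ) : ℂ) • (star a * a)] =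
      !![(√t : ℂ) • 1, (√t⁻¹ : ℂ) • a; 0, 0]ᴴ * !![(√t : ℂ) • 1, (√t⁻¹ : ℂ) • a; 0, 0] := by
    have h₂ : (√t : ℂ) * (√t⁻¹ : ℂ) = 1 := by
      rw [← Complex.ofReal_mul, ← Real.sqrt_mul ht₀.le, mul_inv_cancel₀ ht₀.ne']
      simp
    have h₃ := star_real_sqrt_smul_mul_self (1 : B) ht₀.le
    have h₄ := star_real_sqrt_smul_mul_self a hs
    rw [star_one, one_mul] at h₃
    have h₅ : star ((√t : ℂ) • (1 : B)) * ((√t⁻¹ : ℂ) • a) = a := by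
      rw [star_smul, smul_mul_smul_comm, Complex.star_def, Complex.conj_ofReal, h₂, star_one,
        one_mul, one_smul]
    have h₆ : star ((√t⁻¹ : ℂ) • a) * ((√t : ℂ) • (1 : B)) = star a := by
      rw [← star_star ((√t : ℂ) • (1 : B)), ← star_mul, h₅]
    apply Matrix.ext
    intro i j
    fin_cases i <;> fin_cases j <;>
      simp only [Matrix.mul_apply, Fin.sum_univ_two, Matrix.conjTranspose_apply] <;>
      simp only [Fin.zero_eta, Fin.mk_one, Matrix.of_apply, Matrix.cons_val_zero,
        Matrix.cons_val_one, star_zero, zero_mul, add_zero, h₃, h₄, h₅, h₆]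
  obtain ⟨R, hR⟩ := exists_conjTranspose_mul_self_diag 0 ((√t⁻¹ : ℂ) • w)
  rw [star_real_sqrt_smul_mul_self w hs, ← hw] at hR
  obtain ⟨T, hT⟩ :=
    exists_conjTranspose_mul_self_add !![(√t : ℂ) • (1 : B), (√t⁻¹ : ℂ) • a; 0, 0] R
  refine ⟨T, ?_⟩
  rw [← hT, ← h₁, ← hR]
  have h₇ : ((t⁻¹ : ℝ) : ℂ) • (star a * a) +
      ((t⁻¹ : ℝ) : ℂ) • (((t ^ 2 : ℝ) : ℂ) • (1 : B) - star a * a) = (t : ℂ) • 1 := by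
    rw [← smul_add, add_sub_cancel, smul_smul]
    congr 1
    push_cast
    field_simp
  apply Matrix.ext
  intro i j
  fin_cases i <;> fin_cases j
  · simp
  · simp
  · simp
  · exact h₇.symm

/-- Compressing a positive matrix by `diag(Y, 1)` after a `*`-homomorphism, with the diagonal
filled up to a multiple of the identity. -/
theorem exists_conjTranspose_mul_self_compress (σ : B →⋆ₐ[ℂ] B) (Y : B) {c r ε : ℝ} (hc : 1 ≤ c)
    (hY : ‖Y‖ ^ 2 ≤ c) (hs : 0 ≤ r + ε) {P : Matrix (Fin 2) (Fin 2) B}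
    (hP : ∃ Q : Matrix (Fin 2) (Fin 2) B, (ε : ℂ) • (1 : Matrix (Fin 2) (Fin 2) B) + P = Qᴴ * Q) :
    ∃ T : Matrix (Fin 2) (Fin 2) B, ((c * ε : ℝ) : ℂ) • (1 : Matrix (Fin 2) (Fin 2) B) +
      !![Y * σ (P 0 0) * star Y + (r : ℂ) • ((c : ℂ) • 1 - Y * star Y), Y * σ (P 0 1);
        σ (P 1 0) * star Y, σ (P 1 1) + (r * (c - 1) : ℂ) • 1] = Tᴴ * T := by
  obtain ⟨Q, hQ⟩ := hP
  obtain ⟨w, hw⟩ := exists_smul_one_sub_mul_star_eq Y hY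
  have hv := star_real_sqrt_smul_mul_self (1 : B) (mul_nonneg hs (sub_nonneg.2 hc))
  rw [star_one, one_mul] at hv
  -- The filling is `(r + ε) diag(c - YY*, c - 1)`. Its `ε` part combines with the compressed `ε 1`,
  -- which is `ε diag(YY*, 1)`, to give exactly `cε 1`.
  obtain ⟨R, hR⟩ := exists_conjTranspose_mul_self_diag ((√(r + ε) : ℂ) • w)
    ((√((r + ε) * (c - 1)) : ℂ) • (1 : B))
  rw [star_real_sqrt_smul_mul_self w hs, ← hw, hv] at hR
  obtain ⟨T, hT⟩ := exists_conjTranspose_mul_self_add (Q.map σ * !![Y, 0; 0, 1]ᴴ) R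
  refine ⟨T, ?_⟩
  have hmap : (Q.map σ)ᴴ * Q.map σ = ((ε : ℂ) • (1 : Matrix (Fin 2) (Fin 2) B) + P).map σ := by
    rw [hQ]
    ext i j
    simp [Matrix.mul_apply, map_star]
  have hσ : ∀ z : ℂ, ∀ i j : Fin 2, σ (z • if i = j then (1 : B) else 0) =
      z • if i = j then (1 : B) else 0 := fun z i j => by
    split_ifs <;> simp [map_smul]
  rw [← hT, ← hR, Matrix.conjTranspose_mul, Matrix.conjTranspose_conjTranspose,
    Matrix.mul_assoc, ← Matrix.mul_assoc (Q.map σ)ᴴ, hmap]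
  apply Matrix.ext
  intro i j
  fin_cases i <;> fin_cases j <;>
    simp only [Matrix.mul_apply, Matrix.add_apply, Matrix.smul_apply, Fin.sum_univ_two,
      Matrix.conjTranspose_apply, Matrix.map_apply, Matrix.one_apply, map_add, hσ] <;>
    simp [mul_add, add_mul, mul_assoc, -Complex.coe_smul]
  · module
  · module

end MatrixPositivity

variable {A : Type u} [CStarAlgebra A]

/-! ### Approximation by finitely supported elements -/

theorem exists_finite_support_of_mem_adjoin {I : Set ℤ} {x : Chain A}
    (hx : x ∈ StarAlgebra.adjoin ℂ {y : Chain A | ∃ j ∈ I, ∃ a : A, site j a = y}) :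
    ∃ F : Finset ℤ, ↑F ⊆ I ∧ x ∈ region A (F : Set ℤ) := by
  have key : ∀ x y : Chain A, ∀ F G : Finset ℤ, x ∈ region A (F : Set ℤ) →
      y ∈ region A (G : Set ℤ) → x ∈ region A ((F ∪ G : Finset ℤ) : Set ℤ) ∧
        y ∈ region A ((F ∪ G : Finset ℤ) : Set ℤ) := fun x y F G hx hy =>
    ⟨region_mono (by simp) hx, region_mono (by simp) hy⟩
  induction hx using StarAlgebra.adjoin_induction with
  | mem x h =>
    obtain ⟨j, hj, a, rfl⟩ := h
    exact ⟨{j}, by simpa using hj, site_mem_region (by simp) a⟩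
  | algebraMap r => exact ⟨∅, by simp, algebraMap_mem _ r⟩
  | add x y _ _ h₁ h₂ =>
    obtain ⟨F, hF, hx⟩ := h₁
    obtain ⟨G, hG, hy⟩ := h₂
    have h := key x y F G hx hy
    exact ⟨F ∪ G, by simp [hF, hG], add_mem h.1 h.2⟩
  | mul x y _ _ h₁ h₂ =>
    obtain ⟨F, hF, hx⟩ := h₁
    obtain ⟨G, hG, hy⟩ := h₂
    have h := key x y F G hx hy
    exact ⟨F ∪ G, by simp [hF, hG], mul_mem h.1 h.2⟩
  | star x _ h =>
    obtain ⟨F, hF, hx⟩ := h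
    exact ⟨F, hF, star_mem hx⟩

theorem exists_block_norm_sub_lt (d : right A) {ε : ℝ} (hε : 0 < ε) :
    ∃ n ≥ (1 : ℕ), ∃ y ∈ block A n, ‖y - (d : Chain A)‖ < ε := by
  obtain ⟨y, hy, hyd⟩ := Metric.mem_closure_iff.1 d.2 ε hε
  obtain ⟨F, hF, hyF⟩ := exists_finite_support_of_mem_adjoin hy
  -- The `+ 1` ensures `n ≥ 1` even when `F` is empty.
  refine ⟨F.sup Int.natAbs + 1, by omega, y, region_mono (fun j hj => ?_) hyF, ?_⟩
  · have h₁ : 1 ≤ j := hF hj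
    have h₂ : j.natAbs ≤ F.sup Int.natAbs := Finset.le_sup (f := Int.natAbs) hj
    simp only [Set.mem_Icc]
    omega
  · rwa [dist_comm, dist_eq_norm] at hyd

/-- A continuous functional that does not vanish on the left half chain does not vanish on
all elements of the left half chain with finite support. -/
theorem exists_block_shift_ne_zero (φ : Chain A →L[ℂ] ℂ) {x : Chain A} (hx : x ∈ left A)
    (h : φ x ≠ 0) : ∃ m : ℕ, ∃ y ∈ block A m, φ (shift (-(m : ℤ)) y) ≠ 0 := by
  by_contra! hcon
  refine h ?_
  have hcl : IsClosed {z : Chain A | φ z = 0} := isClosed_eq φ.continuous continuous_const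
  refine closure_minimal (fun z hz => ?_) hcl hx
  obtain ⟨F, hF, hzF⟩ := exists_finite_support_of_mem_adjoin hz
  -- Shifting by one more than the largest `|j|` moves even the leftmost site of `F` to a site `≥
  -- 1`.
  have hm : shift ((F.sup Int.natAbs + 1 : ℕ) : ℤ) z ∈ block A (F.sup Int.natAbs + 1) := by
    refine shift_mem_region _ (fun j hj => ?_) hzF
    have h₁ : j ≤ 0 := hF hj
    have h₂ : j.natAbs ≤ F.sup Int.natAbs := Finset.le_sup (f := Int.natAbs) hj
    simp only [Set.mem_Icc]
    omega
  have := hcon _ _ hm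
  rwa [shift_shift, neg_add_cancel, shift_zero] at this

/-! ### The shift on the right half chain -/

/-- The restriction of `S^n` to an endomorphism of `A_R`. -/
noncomputable def shiftRight (A : Type u) [CStarAlgebra A] (n : ℕ) : right A →⋆ₐ[ℂ] right A :=
  StarAlgHom.codRestrict ((shift (n : ℤ)).comp (right A).subtype) (right A) fun a =>
    shift_mem_region _ (fun j hj => by simp only [Set.mem_Ici] at hj ⊢; omega) a.2

@[simp]
theorem coe_shiftRight (n : ℕ) (a : right A) :
    (shiftRight A n a : Chain A) = shift (n : ℤ) (a : Chain A) := rfl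

/-- The inclusion of `A_(n)` in `A_R`. -/
noncomputable def blockToRight {n : ℕ} : block A n →⋆ₐ[ℂ] right A :=
  StarSubalgebra.inclusion (region_mono fun _ hj => hj.1)

@[simp]
theorem coe_blockToRight {n : ℕ} (y : block A n) : ((blockToRight y : right A) : Chain A) = (y : Chain A) :=
  congrArg (fun f => f y)
    (StarSubalgebra.subtype_comp_inclusion (region_mono (A := A) fun _ hj => hj.1))

/-- `S^n` pushes `A_R` to the sites beyond `n`, disjoint from those of `y`. -/
theorem shiftRight_commute {n : ℕ} (y : block A n) (a : right A) :
    Commute (blockToRight y) (shiftRight A n a) := by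
  have ha : shift (n : ℤ) (a : Chain A) ∈ region A (Set.Ici ((n : ℤ) + 1)) :=
    shift_mem_region _ (fun j hj => by simp only [Set.mem_Ici] at hj ⊢; omega) a.2
  refine Subtype.ext ?_
  rw [MulMemClass.coe_mul, MulMemClass.coe_mul, coe_blockToRight, coe_shiftRight]
  refine region_commute (Set.disjoint_left.2 fun i hi hj => ?_) y.2 ha
  simp only [Set.mem_Icc, Set.mem_Ici] at hi hj
  omega

namespace ShiftInvariantState

/-! ### The generating maps on representatives -/

variable (ω : ShiftInvariantState A)

/-- `S^n` is multiplicative and undoes `S^{-n}` on `y`. This is the working form of `𝔼_(n)`. -/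
theorem genN_tmul_q {n : ℕ} (y : block A n) (a : right A) :
    ω.genN n (y ⊗ₜ[ℂ] ω.q a) = ω.q (blockToRight y * shiftRight A n a) := by
  have h : shiftMul n (shiftBlock A n y) a = blockToRight y * shiftRight A n a := by
    refine Subtype.ext ?_
    rw [MulMemClass.coe_mul, coe_shiftRight, coe_blockToRight]
    have h' : (shiftMul n (shiftBlock A n y) a : Chain A) =
      shift (n : ℤ) (shift (-(n : ℤ)) (y : Chain A) * (a : Chain A)) := rfl
    rw [h', map_mul, shift_shift, add_neg_cancel, shift_zero]
  rw [← h]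
  rfl

theorem reducedShift_q (a : right A) : ω.reducedShift (ω.q a) = ω.q (shiftRight A 1 a) := by
  have h : shiftMul 1 (siteZero A 1) a = shiftRight A 1 a := by
    refine Subtype.ext ?_
    have h' : (shiftMul 1 (siteZero A 1) a : Chain A) =
      shift ((1 : ℕ) : ℤ) (site 0 (1 : A) * (a : Chain A)) := rfl
    rw [h', _root_.map_one (site (A := A) 0), one_mul, coe_shiftRight]
  rw [← h]
  rfl

theorem reducedShift_iterate_q (r : ℕ) (a : right A) :
    ω.reducedShift^[r] (ω.q a) = ω.q (shiftRight A r a) := by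
  induction r with
  | zero => exact congrArg ω.q (Subtype.ext (shift_zero _).symm)
  | succ r ih =>
    rw [Function.iterate_succ_apply', ih, reducedShift_q]
    refine congrArg ω.q (Subtype.ext ?_)
    simp only [coe_shiftRight, shift_shift]
    congr 2
    push_cast
    ring

theorem reducedState_q (a : right A) : ω.reducedState (ω.q a) = ω a :=
  show ω ((1 : Chain A) * (a : Chain A)) = ω a by rw [one_mul]

theorem conj_q (a : right A) : ω.conj (ω.q a) = ω.q (star a) := rfl

theorem conj_genN {n : ℕ} (y : block A n) (b : ω.Reduced) :
    ω.conj (ω.genN n (y ⊗ₜ[ℂ] b)) = ω.genN n (star y ⊗ₜ[ℂ] ω.conj b) := by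
  obtain ⟨a, rfl⟩ := ω.entanglementKernel.mkQ_surjective b
  rw [conj_q, genN_tmul_q, genN_tmul_q, conj_q, (shiftRight_commute y a).eq, star_mul,
    ← StarHomClass.map_star (shiftRight A n), StarHomClass.map_star blockToRight]

theorem genN_tmul_smul_e {n : ℕ} (y : block A n) (r : ℂ) :
    ω.genN n (y ⊗ₜ[ℂ] (r • ω.e)) = r • ω.q (blockToRight y) := by
  rw [TensorProduct.tmul_smul, map_smul, e, genN_tmul_q, _root_.map_one (shiftRight A n), mul_one]

/-- By commutation the two-sided product is `YY* · S^n a`, a representative of `𝔼_(n)(yy* ⊗ ⌊a⌋)`,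
so it depends only on the class of `a`. This is needed since `K_ω` is not assumed to be an ideal. -/
theorem q_mul_shiftRight_mul_star {n : ℕ} (y : block A n) {a : right A} {r : ℂ}
    (ha : ω.q a = r • ω.e) :
    ω.q (blockToRight y * shiftRight A n a * star (blockToRight y)) =
      r • ω.q (blockToRight y * star (blockToRight y)) := by
  rw [← StarHomClass.map_star blockToRight, mul_assoc, ← (shiftRight_commute (star y) a).eq, ← mul_assoc,
    ← map_mul blockToRight, ← genN_tmul_q, ha, genN_tmul_smul_e]

theorem q_shiftRight_of_eq (n : ℕ) {a : right A} {r : ℂ} (ha : ω.q a = r • ω.e) :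
    ω.q (shiftRight A n a) = r • ω.e := by
  have h := ω.genN_tmul_q (1 : block A n) a
  rw [ha, genN_tmul_smul_e, _root_.map_one blockToRight, one_mul] at h
  exact h.symm

/-! ### Positive matrices over the right half chain -/

theorem matrixPos_add {n : ℕ} {P P' : Matrix (Fin n) (Fin n) (right A)}
    (hP : P ∈ matrixPos n) (hP' : P' ∈ matrixPos n) : P + P' ∈ matrixPos n := by
  obtain ⟨Q, rfl⟩ := hP
  obtain ⟨R, rfl⟩ := hP'
  exact exists_conjTranspose_mul_self_add Q R

theorem apply_diag_nonneg {n : ℕ} {P : Matrix (Fin n) (Fin n) (right A)} (hP : P ∈ matrixPos n)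
    (i : Fin n) : 0 ≤ ω (P i i : Chain A) := by
  obtain ⟨Q, rfl⟩ := hP
  have : (((Qᴴ * Q) i i : right A) : Chain A) =
      ∑ j, star (Q j i : Chain A) * (Q j i : Chain A) := by
    simp [Matrix.mul_apply]
  rw [this, map_sum]
  exact Finset.sum_nonneg fun j _ => ω.nonneg _

/-! ### The operator system norm -/

/-- The radii occurring in the definition of the operator system norm. -/
def radii (b : ω.Reduced) : Set ℝ :=
  {r : ℝ | !![(r : ℂ) • ω.e, b; ω.conj b, (r : ℂ) • ω.e] ∈ ω.cone 2}

theorem osyNorm_eq (b : ω.Reduced) : ω.osyNorm b = sInf (ω.radii b) := rfl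

/-- Since `ω` vanishes on `K_ω`, evaluating it at a diagonal entry of the positive lift gives `r + ε
≥ 0`. -/
theorem nonneg_of_mem_radii {b : ω.Reduced} {r : ℝ} (hr : r ∈ ω.radii b) : 0 ≤ r := by
  refine le_of_forall_pos_le_add fun ε hε => ?_
  obtain ⟨P, hPM, hP⟩ := hr ε hε
  have h₀ := ω.apply_diag_nonneg hP 0
  have h₁ : ω.q (P 0 0) = (r : ℂ) • ω.e := congrFun₂ hPM 0 0
  have h₂ : ω (P 0 0 : Chain A) = r := by
    rw [← reducedState_q, h₁, map_smul, e, reducedState_q]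
    show (r : ℂ) • ω.toFunctional 1 = r
    rw [ω.map_one, smul_eq_mul, mul_one]
  have h₃ : ω ((((ε : ℂ) • (1 : Matrix (Fin 2) (Fin 2) (right A)) + P) 0 0 : right A) : Chain A) =
      ((r + ε : ℝ) : ℂ) := by
    show ω.toFunctional ((ε : ℂ) • (1 : Chain A) + (P 0 0 : Chain A)) = _
    rw [map_add, map_smul, ω.map_one, h₂]
    push_cast
    simp [add_comm]
  rw [h₃] at h₀
  exact_mod_cast h₀

theorem bddBelow_radii (b : ω.Reduced) : BddBelow (ω.radii b) :=
  ⟨0, fun _ hr => ω.nonneg_of_mem_radii hr⟩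

theorem norm_mem_radii (a : right A) : ‖a‖ ∈ ω.radii (ω.q a) := by
  intro ε hε
  refine ⟨!![(‖a‖ : ℂ) • 1, a; star a, (‖a‖ : ℂ) • 1], ?_, ?_⟩
  · apply Matrix.ext
    intro i j
    fin_cases i <;> fin_cases j <;> rfl
  · obtain ⟨T, hT⟩ := exists_conjTranspose_mul_self_of_norm_lt a (lt_add_of_pos_right ‖a‖ hε)
    refine ⟨T, ?_⟩
    rw [← hT]
    have h : (ε : ℂ) • (1 : right A) + (‖a‖ : ℂ) • 1 = ((‖a‖ + ε : ℝ) : ℂ) • 1 := by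
      rw [← add_smul, add_comm]
      push_cast
      rfl
    apply Matrix.ext
    intro i j
    rw [Matrix.add_apply, Matrix.smul_apply, Matrix.one_apply]
    fin_cases i <;> fin_cases j
    · exact h
    · exact (congrArg (· + a) (smul_zero (ε : ℂ))).trans (zero_add a)
    · exact (congrArg (· + star a) (smul_zero (ε : ℂ))).trans (zero_add (star a))
    · exact h

theorem osyNorm_q_le (a : right A) : ω.osyNorm (ω.q a) ≤ ‖a‖ :=
  csInf_le (ω.bddBelow_radii _) (ω.norm_mem_radii a)

theorem radii_nonempty (b : ω.Reduced) : (ω.radii b).Nonempty := by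
  obtain ⟨a, rfl⟩ := ω.entanglementKernel.mkQ_surjective b
  exact ⟨_, ω.norm_mem_radii a⟩

theorem conj_add (b b' : ω.Reduced) : ω.conj (b + b') = ω.conj b + ω.conj b' := by
  obtain ⟨a, rfl⟩ := ω.entanglementKernel.mkQ_surjective b
  obtain ⟨a', rfl⟩ := ω.entanglementKernel.mkQ_surjective b'
  rw [← map_add, conj_q, conj_q, conj_q, star_add, map_add]

theorem add_mem_radii {b b' : ω.Reduced} {r r' : ℝ} (hr : r ∈ ω.radii b) (hr' : r' ∈ ω.radii b') :
    r + r' ∈ ω.radii (b + b') := by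
  intro ε hε
  obtain ⟨P, hPM, hP⟩ := hr (ε / 2) (by positivity)
  obtain ⟨P', hPM', hP'⟩ := hr' (ε / 2) (by positivity)
  refine ⟨P + P', ?_, ?_⟩
  · rw [Matrix.map_add _ (map_add ω.q), hPM, hPM', conj_add]
    ext i j
    fin_cases i <;> fin_cases j <;> simp [add_smul]
  · convert matrixPos_add hP hP' using 1
    rw [add_add_add_comm, ← add_smul]
    push_cast
    rw [add_halves]

theorem osyNorm_add_le (b b' : ω.Reduced) : ω.osyNorm (b + b') ≤ ω.osyNorm b + ω.osyNorm b' := by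
  refine le_of_forall_pos_lt_add fun ε hε => ?_
  obtain ⟨r, hr, hrb⟩ := Real.lt_sInf_add_pos (ω.radii_nonempty b) (half_pos hε)
  obtain ⟨r', hr', hrb'⟩ := Real.lt_sInf_add_pos (ω.radii_nonempty b') (half_pos hε)
  have := csInf_le (ω.bddBelow_radii _) (ω.add_mem_radii hr hr')
  simp only [osyNorm_eq]
  linarith

theorem mul_mem_radii_genN {n : ℕ} (y : block A n) {c : ℝ} (hc : 1 ≤ c)
    (hyc : ‖blockToRight y‖ ^ 2 ≤ c) {b : ω.Reduced} {r : ℝ} (hr : r ∈ ω.radii b) :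
    c * r ∈ ω.radii (ω.genN n (y ⊗ₜ[ℂ] b)) := by
  intro δ hδ
  have hc₀ : 0 < c := by linarith
  -- The compression multiplies the tolerance by `c`, so `δ / c` returns `δ`.
  have hε : 0 < δ / c := by positivity
  obtain ⟨P, hPM, hP⟩ := hr (δ / c) hε
  obtain ⟨T, hT⟩ := exists_conjTranspose_mul_self_compress (shiftRight A n) (blockToRight y) hc hyc
    (add_nonneg (ω.nonneg_of_mem_radii hr) hε.le) hP
  rw [mul_div_cancel₀ _ hc₀.ne'] at hT
  refine ⟨_, ?_, T, hT⟩
  have h00 : ω.q (P 0 0) = (r : ℂ) • ω.e := congrFun₂ hPM 0 0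
  have h01 : ω.q (P 0 1) = b := congrFun₂ hPM 0 1
  have h10 : ω.q (P 1 0) = ω.conj b := congrFun₂ hPM 1 0
  have h11 : ω.q (P 1 1) = (r : ℂ) • ω.e := congrFun₂ hPM 1 1
  have g00 := ω.q_mul_shiftRight_mul_star y h00
  have g01 : ω.q (blockToRight y * shiftRight A n (P 0 1)) = ω.genN n (y ⊗ₜ[ℂ] b) := by
    rw [← genN_tmul_q, h01]
  have g10 : ω.q (shiftRight A n (P 1 0) * star (blockToRight y)) =
      ω.conj (ω.genN n (y ⊗ₜ[ℂ] b)) := by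
    rw [← StarHomClass.map_star blockToRight, ← (shiftRight_commute (star y) (P 1 0)).eq, conj_genN, ← h10,
      genN_tmul_q]
  have g11 := ω.q_shiftRight_of_eq n h11
  have k00 : ω.q (blockToRight y * shiftRight A n (P 0 0) * star (blockToRight y) +
      (r : ℂ) • ((c : ℂ) • 1 - blockToRight y * star (blockToRight y))) =
      ((c * r : ℝ) : ℂ) • ω.e := by
    rw [map_add, map_smul, map_sub, map_smul, g00, e]
    push_cast
    module
  have k11 : ω.q (shiftRight A n (P 1 1) + (r * (c - 1) : ℂ) • 1) = ((c * r : ℝ) : ℂ) • ω.e := by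
    rw [map_add, map_smul, g11, e]
    push_cast
    module
  apply Matrix.ext
  intro i j
  fin_cases i <;> fin_cases j
  · exact k00
  · exact g01
  · exact g10
  · exact k11

theorem exists_osyNorm_genN_le {n : ℕ} (y : block A n) :
    ∃ c : ℝ, ∀ b : ω.Reduced, ω.osyNorm (ω.genN n (y ⊗ₜ[ℂ] b)) ≤ c * ω.osyNorm b := by
  set c : ℝ := max 1 (‖blockToRight y‖ ^ 2)
  have hc : 0 < c := lt_of_lt_of_le one_pos (le_max_left _ _)
  refine ⟨c, fun b => ?_⟩
  rw [← div_le_iff₀' hc]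
  refine le_csInf (ω.radii_nonempty b) fun r hr => ?_
  rw [div_le_iff₀' hc]
  exact csInf_le (ω.bddBelow_radii _)
    (ω.mul_mem_radii_genN y (le_max_left _ _) (le_max_right _ _) hr)

/-! ### Fullness -/

theorem exists_reducedState_genN_ne_zero {b : ω.Reduced} (hb : b ≠ 0) :
    ∃ m : ℕ, ∃ x : block A m, ω.reducedState (ω.genN m (x ⊗ₜ[ℂ] b)) ≠ 0 := by
  obtain ⟨a, rfl⟩ := ω.entanglementKernel.mkQ_surjective b
  have ha : a ∉ ω.entanglementKernel := fun h => hb ((Submodule.Quotient.mk_eq_zero _).2 h)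
  rw [mem_entanglementKernel] at ha
  push Not at ha
  obtain ⟨x, hx, hxa⟩ := ha
  -- The functional is `z ↦ ω(z a)`.
  obtain ⟨m, y, hy, hya⟩ := exists_block_shift_ne_zero
    (ω.toFunctional.comp ((ContinuousLinearMap.mul ℂ (Chain A)).flip (a : Chain A))) hx hxa
  refine ⟨m, ⟨y, hy⟩, ?_⟩
  rw [genN_tmul_q, reducedState_q, ← ω.map_shift_int (-(m : ℤ)), MulMemClass.coe_mul,
    coe_shiftRight, coe_blockToRight, map_mul, shift_shift, neg_add_cancel, shift_zero]
  exact hya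

/-- The composition rule of the generating maps: acting first with `x`, then `r` times with the
unit and then with `y` amounts to acting with `y · S^{n+r} x`. -/
theorem genN_comp {n m r : ℕ} (y : block A n) (x : block A m) (b : ω.Reduced) :
    ∃ z : block A (n + (r + m)), ω.genN (n + (r + m)) (z ⊗ₜ[ℂ] b) =
      ω.genN n (y ⊗ₜ[ℂ] ω.reducedShift^[r] (ω.genN m (x ⊗ₜ[ℂ] b))) := by
  obtain ⟨a, rfl⟩ := ω.entanglementKernel.mkQ_surjective b
  refine ⟨⟨(y : Chain A) * shift ((n + r : ℕ) : ℤ) (x : Chain A), mul_mem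
    (region_mono (fun j hj => ?_) y.2) (shift_mem_region _ (fun j hj => ?_) x.2)⟩, ?_⟩
  · simp only [Set.mem_Icc] at hj ⊢
    omega
  · simp only [Set.mem_Icc] at hj ⊢
    omega
  · rw [genN_tmul_q, genN_tmul_q, reducedShift_iterate_q, genN_tmul_q]
    refine congrArg ω.q (Subtype.ext ?_)
    simp only [MulMemClass.coe_mul, coe_shiftRight, coe_blockToRight]
    rw [map_mul, map_mul, shift_shift, shift_shift, shift_shift, mul_assoc]
    push_cast
    rw [add_assoc]

end ShiftInvariantState

end SpinChain

/-! ### Density of the orbit of a nonzero element -/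

open SpinChain in
theorem mainTheorem9 {A : Type*} [CStarAlgebra A] (ω : ShiftInvariantState A)
    (h : ∀ b : ω.Reduced,
      Tendsto (fun r : ℕ => ω.osyNorm (ω.reducedShift^[r] b - ω.reducedState b • ω.e))
        atTop (𝓝 0)) :
    ω.IsFull := by
  intro b hb
  refine Set.eq_univ_of_forall fun c ε hε => ?_
  obtain ⟨d, rfl⟩ := ω.entanglementKernel.mkQ_surjective c
  obtain ⟨m, x, hx⟩ := ω.exists_reducedState_genN_ne_zero hb
  obtain ⟨n, hn, y, hy, hyd⟩ := exists_block_norm_sub_lt d (half_pos hε)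
  set b' := ω.genN m (x ⊗ₜ[ℂ] b)
  set t := ω.reducedState b'
  let y' : block A n := ⟨y, hy⟩
  -- `C` depends only on `t⁻¹ y'`, so `r` can be chosen afterwards. The factor `t⁻¹` makes the limit
  -- `t e` go to `⌊y'⌋`.
  obtain ⟨C, hC⟩ := ω.exists_osyNorm_genN_le (t⁻¹ • y')
  have hlim : Tendsto (fun r : ℕ => C * ω.osyNorm (ω.reducedShift^[r] b' - t • ω.e)) atTop (𝓝 0) := by
    simpa using (h b').const_mul C
  obtain ⟨r, hr⟩ := (hlim.eventually (gt_mem_nhds (half_pos hε))).exists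
  obtain ⟨z, hz⟩ := ω.genN_comp (r := r) (t⁻¹ • y') x b
  refine ⟨_, Set.mem_iUnion₂.2 ⟨n + (r + m), by omega, Set.mem_iUnion.2 ⟨z, rfl⟩⟩, ?_⟩
  have hsplit : ω.genN (n + (r + m)) (z ⊗ₜ[ℂ] b) - ω.q d =
      ω.genN n ((t⁻¹ • y') ⊗ₜ[ℂ] (ω.reducedShift^[r] b' - t • ω.e)) +
        ω.q (blockToRight y' - d) := by
    have h₁ : ω.genN n ((t⁻¹ • y') ⊗ₜ[ℂ] (t • ω.e)) = ω.q (blockToRight y') := by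
      rw [TensorProduct.smul_tmul, smul_smul, inv_mul_cancel₀ hx, ω.genN_tmul_smul_e, one_smul]
    rw [hz, TensorProduct.tmul_sub, map_sub, h₁, map_sub]
    abel
  have hle : ω.osyNorm (ω.q (blockToRight y' - d)) < ε / 2 :=
    (ω.osyNorm_q_le _).trans_lt hyd
  rw [hsplit]
  linarith [ω.osyNorm_add_le (ω.genN n ((t⁻¹ • y') ⊗ₜ[ℂ] (ω.reducedShift^[r] b' - t • ω.e)))
    (ω.q (blockToRight y' - d)), hC (ω.reducedShift^[r] b' - t • ω.e)]
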